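/- A symmetric $(v,k,1)$-covering is a set $V$ of $v$ points together with a collection of exactly $v$ blocks, each a $k$-element subset of $V$ (repeated blocks are allowed), such that any two distinct points $x,y$ lie together in $r_{xy}\ge 1$ blocks. Its excess is the multigraph on $V$ in which the edge joining distinct points $x$ and $y$ has multiplicity $r_{xy}-1$. The excess has cycle type $[c_1,\ldots,c_t]$, where $2\le c_1\le\cdots\le c_t$, if it is a vertex-disjoint union of cycles of lengths $c_1,\ldots,c_t$ that together contain every point of $V$; here a pair of parallel edges is a cycle of length $2$. The notation $4^{\ell}$ stands for $\ell$ entries equal to $4$. Let $k$ be a positive integer with $k\equiv 7,31,34$ or $58\pmod{72}$, and let $v=k(k-1)-1$. Then there does not exist a symmetric $(v,k,1)$-covering whose excess has cycle type $[2,3,4^{(v-5)/4}]$. -/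

import Mathlib

namespace SymmCovering

/-- A loopless multigraph with vertex set `V`, given by its edge multiplicities: `mult x y` is the
number of edges joining `x` and `y`. -/
structure Multigraph (V : Type*) where
  mult : V → V → ℕ
  symm : ∀ x y, mult x y = mult y x
  loopless : ∀ x, mult x x = 0

/-- The cycle of length `n` (meant for `2 ≤ n`) on the vertices `0, 1, …, n - 1`, with one edge
joining `i` and `i + 1 mod n` for each `i`. For `n = 2` this is a pair of parallel edges. -/
def cycle (n : ℕ) : Multigraph (Fin n) where
  mult i j := if i = j then 0 else
    (if (i.val + 1) % n = j.val then 1 else 0) + (if (j.val + 1) % n = i.val then 1 else 0)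
  symm i j := by simp only [eq_comm (a := i), add_comm]
  loopless i := by simp

/-- `G` has cycle type `[c₁, …, c_t]`: the list is nondecreasing with all entries at least `2`, and
`G` is the vertex-disjoint union of cycles of lengths `c₁, …, c_t`, which together use every vertex.
The bijection `e` lists the vertices of `G` cycle by cycle. -/
def Multigraph.HasCycleType {V : Type*} (G : Multigraph V) (c : List ℕ) : Prop :=
  c.Pairwise (· ≤ ·) ∧ (∀ n ∈ c, 2 ≤ n) ∧
    ∃ e : (Σ i : Fin c.length, Fin (c.get i)) ≃ V,
      (∀ i a b, G.mult (e ⟨i, a⟩) (e ⟨i, b⟩) = (cycle (c.get i)).mult a b) ∧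
      (∀ i j a b, i ≠ j → G.mult (e ⟨i, a⟩) (e ⟨j, b⟩) = 0)

/-- The number of blocks (counted with repetition) that contain both `x` and `y`. -/
def pairCount {V : Type*} [DecidableEq V] (blocks : Multiset (Finset V)) (x y : V) : ℕ :=
  (blocks.filter (fun b => x ∈ b ∧ y ∈ b)).card

/-- A `(v, k, lam)`-covering with point set `V`: a collection of `k`-subsets of `V` (repeated
blocks are allowed) such that each pair of distinct points lies in at least `lam` blocks. -/
structure Covering (V : Type*) [Fintype V] [DecidableEq V] (v k lam : ℕ) where
  blocks : Multiset (Finset V)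
  card_points : Fintype.card V = v
  card_block : ∀ b ∈ blocks, b.card = k
  covers : ∀ x y, x ≠ y → lam ≤ pairCount blocks x y

namespace Covering

variable {V : Type*} [Fintype V] [DecidableEq V] {v k lam : ℕ}

/-- A covering is symmetric if it has as many blocks as points. -/
def IsSymmetric (C : Covering V v k lam) : Prop :=
  C.blocks.card = v

/-- The excess of a covering: the multigraph on the points in which the edge joining the distinct
points `x` and `y` has multiplicity `r_{xy} - lam`, where `r_{xy}` is the number of blocks
containing both. The subtraction never truncates, by the field `covers`. -/
def excess (C : Covering V v k lam) : Multigraph V where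
  mult x y := if x = y then 0 else pairCount C.blocks x y - lam
  symm x y := by simp only [pairCount, eq_comm (a := x), and_comm]
  loopless x := by simp

end Covering

end SymmCovering

open Matrix

/-! Let `N` be the incidence matrix, square because the covering is symmetric. With `c = k - 1` and
`A` the adjacency matrix of the excess, `N * Nᵀ = c I + J + A`. The congruences on `k` make `3`
divide `c` exactly once and make the number `l` of 4-cycles an odd multiple of 3.

Modulo 3, the kernel of `N * Nᵀ` is the `2 * l`-dimensional space of antipodal vectors
(`eq_antipodal`). Since `N` is square, rank-nullity forces `ker Nᵀ`, which lies in that space, to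
have dimension at least `l`. If an integral antipodal vector lies in `ker Nᵀ` modulo 3, its image
under `Nᵀ` has squared norm divisible by 9 and equal to `c` times its own squared norm, which is
therefore divisible by 3. So `ker Nᵀ` gives a totally isotropic subspace for a sum of `2 * l`
squares over `ZMod 3`. For odd `l` its dimension is less than `l` (`finrank_lt_of_isotropic`), a
contradiction. -/

/-- If `-1` is not a square, a sum of `2 n` squares with `n` odd has no totally isotropic
subspace of dimension `n`. -/
theorem finrank_lt_of_isotropic {F ι : Type*} [Field F] [Fintype ι] [DecidableEq ι]
    (h2 : (2 : F) ≠ 0) (hF : ¬ IsSquare (-1 : F)) {n : ℕ} (hn : Odd n)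
    (hι : Fintype.card ι = 2 * n) (K : Submodule F (ι → F)) (hK : ∀ x ∈ K, x ⬝ᵥ x = 0) :
    Module.finrank F K < n := by
  by_contra! hle
  have hpol : ∀ x ∈ K, ∀ y ∈ K, x ⬝ᵥ y = 0 := by
    intro x hx y hy
    have h := hK _ (K.add_mem hx hy)
    rw [add_dotProduct, dotProduct_add, dotProduct_add, hK x hx, hK y hy, dotProduct_comm y x] at h
    have : (2 : F) * (x ⬝ᵥ y) = 0 := by linear_combination h
    exact (mul_eq_zero.1 this).resolve_left h2
  obtain ⟨b, hb⟩ := exists_linearIndependent_of_le_finrank hle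
  let B : Matrix (Fin n) ι F := fun i => (b i : ι → F)
  have hB : LinearIndependent F B.row := hb.map' K.subtype K.ker_subtype
  have hBB : B * Bᵀ = 0 := by
    ext i j
    exact hpol _ (b i).2 _ (b j).2
  have hrank : B.rank = n := by simpa using hB.rank_matrix
  -- Select `n` independent columns, forming an invertible `P`; the other `n` form `Q`. Then `P * Pᵀ
  -- = -(Q * Qᵀ)`, and for odd `n` determinants give `-1 = (det P / det Q) ^ 2`.
  obtain ⟨κ, s, hs, hspan, hli⟩ := exists_linearIndependent' F B.col
  have : Finite κ := Finite.of_injective s hs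
  have := Fintype.ofFinite κ
  have hκ : Fintype.card κ = n := by
    rw [← finrank_span_eq_card hli, hspan, ← Matrix.rank_eq_finrank_span_cols, hrank]
  let e₁ : Fin n ≃ κ := (Fintype.equivFinOfCardEq hκ).symm
  let t : Fin n → ι := s ∘ e₁
  have ht : Function.Injective t := hs.comp e₁.injective
  have hcompl : Fintype.card {i // i ∉ Set.range t} = n := by
    rw [Fintype.card_subtype_compl, hι, Set.card_range_of_injective ht]
    simp; omega
  let e₀ : Fin n ≃ {i // i ∈ Set.range t} := Equiv.ofInjective t ht
  let e₂ : Fin n ≃ {i // i ∉ Set.range t} := (Fintype.equivFinOfCardEq hcompl).symm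
  let P : Matrix (Fin n) (Fin n) F := B.submatrix id t
  let Q : Matrix (Fin n) (Fin n) F := B.submatrix id (fun i => e₂ i)
  have hsum : P * Pᵀ = -(Q * Qᵀ) := by
    rw [eq_neg_iff_add_eq_zero, ← hBB]
    ext i j
    simp only [Matrix.add_apply, Matrix.mul_apply, transpose_apply, P, Q, submatrix_apply, id]
    rw [← Fintype.sum_subtype_add_sum_subtype (fun x => x ∈ Set.range t)]
    congr 1
    · convert e₀.sum_comp (fun x => B i x * B j x) <;> rfl
    · exact e₂.sum_comp (fun x : {i // i ∉ Set.range t} => B i x * B j x)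
  have hP : P.det ≠ 0 := by
    have h : LinearIndependent F P.col := hli.comp e₁ e₁.injective
    exact (Matrix.isUnit_iff_isUnit_det _).1 (Matrix.linearIndependent_cols_iff_isUnit.1 h) |>.ne_zero
  have hdet := congrArg Matrix.det hsum
  rw [det_neg, det_mul, det_mul, det_transpose, det_transpose, Fintype.card_fin, hn.neg_one_pow]
    at hdet
  apply hF
  have hQ : Q.det ≠ 0 := by
    intro h
    rw [h] at hdet
    exact hP (by simpa using hdet)
  refine ⟨P.det / Q.det, ?_⟩
  field_simp
  linear_combination -hdet

namespace SymmCovering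

/-! ### Coordinates for the union of cycles. -/

/-- The vertices of a disjoint union of a 2-cycle, a 3-cycle and `l` 4-cycles. -/
abbrev CyclePoints (l : ℕ) : Type := Fin 2 ⊕ Fin 3 ⊕ Fin l × Fin 4

/-- The edge multiplicities of a disjoint union of a 2-cycle, a 3-cycle and `l` 4-cycles. -/
def cycleUnion (l : ℕ) : CyclePoints l → CyclePoints l → ℕ
  | .inl i, .inl j => (cycle 2).mult i j
  | .inr (.inl i), .inr (.inl j) => (cycle 3).mult i j
  | .inr (.inr p), .inr (.inr q) => if p.1 = q.1 then (cycle 4).mult p.2 q.2 else 0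
  | _, _ => 0

section

variable {R : Type*} [CommRing R] {l : ℕ} (w : CyclePoints l → R)

theorem sum_cycleUnion_inl (i : Fin 2) :
    ∑ q, (cycleUnion l (.inl i) q : R) * w q = 2 * w (.inl (i + 1)) := by
  fin_cases i <;> simp [cycleUnion, cycle, Fin.sum_univ_succ] <;> ring

theorem sum_cycleUnion_inr_inl (i : Fin 3) :
    ∑ q, (cycleUnion l (.inr (.inl i)) q : R) * w q =
      w (.inr (.inl (i + 1))) + w (.inr (.inl (i + 2))) := by
  fin_cases i <;> simp [cycleUnion, cycle, Fin.sum_univ_succ]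
  exact add_comm _ _

theorem sum_cycleUnion_inr_inr (j : Fin l) (i : Fin 4) :
    ∑ q, (cycleUnion l (.inr (.inr (j, i))) q : R) * w q =
      w (.inr (.inr (j, i + 1))) + w (.inr (.inr (j, i + 3))) := by
  simp only [Fintype.sum_sum_type, Fintype.sum_prod_type, cycleUnion]
  rw [Finset.sum_eq_single j (fun b _ hb => by simp [Ne.symm hb]) (by simp)]
  fin_cases i <;> simp [cycle, Fin.sum_univ_succ] <;> exact add_comm _ _

end

theorem cycle_mult_cast {m n : ℕ} (h : m = n) (a b : Fin n) :
    (cycle m).mult (finCongr h.symm a) (finCongr h.symm b) = (cycle n).mult a b := by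
  subst h; rfl

theorem Multigraph.HasCycleType.exists_equiv_cyclePoints {V : Type*} {G : Multigraph V} {l : ℕ}
    (h : G.HasCycleType (2 :: 3 :: List.replicate l 4)) :
    ∃ e : CyclePoints l ≃ V, ∀ p q, G.mult (e p) (e q) = cycleUnion l p q := by
  obtain ⟨-, -, e, he, he'⟩ := h
  have hlen : (2 :: 3 :: List.replicate l 4).length = l + 2 := by simp
  have hget (j : Fin l) :
      (2 :: 3 :: List.replicate l 4).get (finCongr hlen.symm j.succ.succ) = 4 := by
    simp
  let f : CyclePoints l →
      Σ i : Fin (2 :: 3 :: List.replicate l 4).length, Fin ((2 :: 3 :: List.replicate l 4).get i)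
    | .inl i => ⟨finCongr hlen.symm 0, i⟩
    | .inr (.inl i) => ⟨finCongr hlen.symm 1, i⟩
    | .inr (.inr p) => ⟨finCongr hlen.symm p.1.succ.succ, finCongr (hget p.1).symm p.2⟩
  have hf : Function.Surjective f := by
    rintro ⟨i, a⟩
    obtain ⟨i, rfl⟩ := (finCongr hlen.symm).surjective i
    induction i using Fin.cases with
    | zero => exact ⟨.inl a, rfl⟩
    | succ i =>
      induction i using Fin.cases with
      | zero => exact ⟨.inr (.inl a), rfl⟩
      | succ j => exact ⟨.inr (.inr (j, finCongr (hget j) a)), rfl⟩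
  have hinj : Function.Injective f := by
    rintro (a | a | ⟨j, a⟩) (b | b | ⟨j', b⟩) hab <;> have h1 := congrArg (fun x => x.1.val) hab <;>
      simp [f] at h1
    · have := eq_of_heq (Sigma.mk.inj hab).2
      rw [this]
    · have := eq_of_heq (Sigma.mk.inj hab).2
      rw [this]
    · have : j = j' := Fin.ext h1
      subst this
      have : a = b := (finCongr (hget j).symm).injective (eq_of_heq (Sigma.mk.inj hab).2)
      rw [this]
  refine ⟨(Equiv.ofBijective f ⟨hinj, hf⟩).trans e, ?_⟩
  rintro (a | a | ⟨j, a⟩) (b | b | ⟨j', b⟩)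
  · exact he (finCongr hlen.symm 0) a b
  · exact he' _ _ _ _ (by simp [Fin.ext_iff])
  · exact he' _ _ _ _ (by simp [Fin.ext_iff])
  · exact he' _ _ _ _ (by simp [Fin.ext_iff])
  · exact he (finCongr hlen.symm 1) a b
  · exact he' _ _ _ _ (by simp [Fin.ext_iff])
  · exact he' _ _ _ _ (by simp [Fin.ext_iff])
  · exact he' _ _ _ _ (by simp [Fin.ext_iff])
  · by_cases hj : j = j'
    · subst hj
      exact (he _ _ _).trans ((cycle_mult_cast (hget j) a b).trans (by simp [cycleUnion]))
    · exact (he' _ _ _ _ (by simpa [Fin.ext_iff] using hj)).trans (by simp [cycleUnion, hj])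

/-! ### Blocks indexed by points, and double counting. -/

theorem exists_eq_map_univ {V : Type*} [Fintype V] [DecidableEq V] (s : Multiset (Finset V))
    (hs : s.card = Fintype.card V) :
    ∃ f : V → Finset V, s = Finset.univ.val.map f := by
  induction s using Quot.inductionOn with | _ t
  replace hs : t.length = Fintype.card V := hs
  let e : V ≃ Fin t.length := Fintype.equivFinOfCardEq hs.symm
  refine ⟨fun x => t.get (e x), ?_⟩
  have : (Finset.univ : Finset (Fin t.length)) = Finset.univ.map e.toEmbedding := by simp
  change (t : Multiset (Finset V)) = _
  conv_lhs => rw [← List.ofFn_get t, ← Fin.univ_val_map, this]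
  simp only [Finset.map_val, Multiset.map_map]
  rfl

theorem pairCount_eq_sum {V : Type*} [Fintype V] [DecidableEq V] (f : V → Finset V) (x y : V) :
    pairCount (Finset.univ.val.map f) x y =
      ∑ b, (if x ∈ f b then 1 else 0) * (if y ∈ f b then 1 else 0) := by
  simp only [pairCount, Multiset.filter_map, Multiset.card_map, ← ite_and, mul_ite, mul_one,
    mul_zero, ← Finset.card_filter]
  simp [Finset.card_def, and_comm]

theorem sum_pairCount {V : Type*} [Fintype V] [DecidableEq V] {f : V → Finset V} {k : ℕ}
    (hf : ∀ b, (f b).card = k) (x : V) :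
    ∑ y, pairCount (Finset.univ.val.map f) x y = pairCount (Finset.univ.val.map f) x x * k := by
  simp only [pairCount_eq_sum]
  rw [Finset.sum_comm, Finset.sum_mul]
  refine Finset.sum_congr rfl fun b _ => ?_
  rw [← Finset.mul_sum, ← Finset.card_filter]
  simp +contextual [hf]

/-! ### Antipodal vectors and the Gram matrix modulo 3. -/

/-- The vectors that vanish on the 2-cycle and the 3-cycle and take opposite values at opposite
vertices of each 4-cycle. -/
def antipodal (R : Type*) [CommRing R] (l : ℕ) :
    (Fin l × Fin 2 → R) →ₗ[R] (CyclePoints l → R) where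
  toFun z
    | .inr (.inr (j, i)) => ![z (j, 0), z (j, 1), -z (j, 0), -z (j, 1)] i
    | _ => 0
  map_add' z z' := by
    ext (i | i | ⟨j, i⟩)
    · simp
    · simp
    · fin_cases i <;> simp [add_comm]
  map_smul' c z := by
    ext (i | i | ⟨j, i⟩)
    · simp
    · simp
    · fin_cases i <;> simp

section

variable {R : Type*} [CommRing R] {l : ℕ} (z : Fin l × Fin 2 → R)

theorem sum_antipodal : ∑ p, antipodal R l z p = 0 := by
  simp [Fintype.sum_prod_type, antipodal, Fin.sum_univ_four]

theorem sum_antipodal_sq : ∑ p, antipodal R l z p * antipodal R l z p = 2 * ∑ p, z p * z p := by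
  simp only [Fintype.sum_sum_type, Fintype.sum_prod_type, antipodal, LinearMap.coe_mk,
    AddHom.coe_mk, Fin.sum_univ_four, Fin.sum_univ_two, Finset.mul_sum]
  simp only [mul_zero, Finset.sum_const_zero, zero_add, add_zero]
  refine Finset.sum_congr rfl fun j _ => ?_
  simp
  ring

theorem sum_cycleUnion_antipodal (p : CyclePoints l) :
    ∑ q, (cycleUnion l p q : R) * antipodal R l z q = 0 := by
  obtain i | i | ⟨j, i⟩ := p
  · rw [sum_cycleUnion_inl]
    simp [antipodal]
  · rw [sum_cycleUnion_inr_inl]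
    simp [antipodal]
  · rw [sum_cycleUnion_inr_inr]
    fin_cases i <;> simp [antipodal]

/-- The Gram matrix of the points of a symmetric covering whose excess is a union of cycles
is `k - 1` times the identity, plus the all-ones matrix, plus the adjacency matrix. -/
theorem sum_gram_mul (c : R) (w : CyclePoints l → R) (p : CyclePoints l) :
    ∑ q, ((if p = q then c else 0) + 1 + (cycleUnion l p q : R)) * w q =
      c * w p + ∑ q, w q + ∑ q, (cycleUnion l p q : R) * w q := by
  simp [add_mul, Finset.sum_add_distrib]

end

/-- A vector in the kernel of the Gram matrix modulo 3 is determined by two consecutive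
vertices of each 4-cycle. -/
theorem eq_antipodal {l : ℕ} (hl : 3 ∣ l) (w : CyclePoints l → ZMod 3)
    (hw : ∀ p, ∑ q, w q + ∑ q, (cycleUnion l p q : ZMod 3) * w q = 0) :
    antipodal (ZMod 3) l (fun p => w (.inr (.inr (p.1, Fin.castLE (by norm_num) p.2)))) = w := by
  obtain ⟨s, hs⟩ : ∃ s, s = ∑ q, w q := ⟨_, rfl⟩
  have h3 : (3 : ZMod 3) = 0 := rfl
  rw [← hs] at hw
  have h₂ (i : Fin 2) : w (.inl i) = s := by
    have := hw (.inl (i + 1))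
    rw [sum_cycleUnion_inl, add_assoc, show (1 + 1 : Fin 2) = 0 from rfl, add_zero] at this
    linear_combination -this + w (.inl i) * h3
  have h₃ (i : Fin 3) : w (.inr (.inl i)) = w (.inr (.inl 0)) ∧ s = w (.inr (.inl 0)) := by
    have h0 := hw (.inr (.inl 0))
    have h1 := hw (.inr (.inl 1))
    have h2 := hw (.inr (.inl 2))
    rw [sum_cycleUnion_inr_inl] at h0 h1 h2
    simp only [Fin.isValue, zero_add, show (1 + 1 : Fin 3) = 2 from rfl,
      show (1 + 2 : Fin 3) = 0 from rfl,
      show (2 + 1 : Fin 3) = 0 from rfl,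
      show (2 + 2 : Fin 3) = 1 from rfl] at h0 h1 h2
    have e1 : w (.inr (.inl 1)) = w (.inr (.inl 0)) := by linear_combination h0 - h1
    have e2 : w (.inr (.inl 2)) = w (.inr (.inl 0)) := by linear_combination h0 - h2
    refine ⟨by fin_cases i <;> simp [e1, e2], ?_⟩
    linear_combination h0 - e1 - e2 - w (.inr (.inl 0)) * h3
  have h₄ (j : Fin l) (i : Fin 4) : w (.inr (.inr (j, i))) + w (.inr (.inr (j, i + 2))) = -s := by
    have := hw (.inr (.inr (j, i + 3)))
    rw [sum_cycleUnion_inr_inr, add_assoc, add_assoc, show (3 + 1 : Fin 4) = 0 from rfl,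
      show (3 + 3 : Fin 4) = 2 from rfl, add_zero] at this
    linear_combination this
  have hl' : (l : ZMod 3) = 0 := (ZMod.natCast_eq_zero_iff _ _).2 hl
  -- Modulo 3 the 2-cycle contributes `2 * s`, the triangle `3 * s = 0`, and each 4-cycle `-2 * s =
  -- s`. As `3 ∣ l`, the total gives `s = 2 * s`.
  have hs0 : s = 0 := by
    have h4 (j : Fin l) : ∑ i, w (.inr (.inr (j, i))) = s := by
      rw [Fin.sum_univ_four]
      have a := h₄ j 0
      have b := h₄ j 1
      simp only [Fin.isValue, zero_add, show (1 + 2 : Fin 4) = 3 from rfl] at a b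
      linear_combination a + b - s * h3
    have h := hs
    simp only [Fintype.sum_sum_type, Fintype.sum_prod_type, h₂, h4, Fin.sum_univ_three,
      (h₃ 1).1, (h₃ 2).1, ← (h₃ 0).2] at h
    simp [hl'] at h
    linear_combination -h - s * h3
  ext (i | i | ⟨j, i⟩)
  · simp [antipodal, h₂, hs0]
  · simp [antipodal, (h₃ i).1, ← (h₃ i).2, hs0]
  · have a := h₄ j 0
    have b := h₄ j 1
    simp only [Fin.isValue, zero_add, show (1 + 2 : Fin 4) = 3 from rfl, hs0, neg_zero] at a b
    fin_cases i
    · simp [antipodal]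
    · simp [antipodal]
    · simpa [antipodal] using (eq_neg_of_add_eq_zero_right a).symm
    · simpa [antipodal] using (eq_neg_of_add_eq_zero_right b).symm

/-- The Gram matrix of a symmetric covering with this excess is not of the form `A * Aᵀ`: the
kernel of `Aᵀ` modulo 3 would be a totally isotropic subspace of half the dimension in a sum of
`2 * l` squares. -/
theorem not_exists_gram {l : ℕ} (hl : 3 ∣ l) (hodd : Odd l) {c : ℤ} (hc : 3 ∣ c) (hc' : ¬ 9 ∣ c)
    {β : Type*} [Fintype β] (hβ : Fintype.card β = Fintype.card (CyclePoints l))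
    (A : Matrix (CyclePoints l) β ℤ)
    (hA : ∀ p q, ∑ b, A p b * A q b = (if p = q then c else 0) + 1 + cycleUnion l p q) : False := by
  have two_ne : (2 : ZMod 3) ≠ 0 := by decide
  have neg_one : ¬ IsSquare (-1 : ZMod 3) := by decide
  have hp : Fact (Nat.Prime 3) := ⟨Nat.prime_three⟩
  let B : Matrix (CyclePoints l) β (ZMod 3) := A.map (Int.castRingHom (ZMod 3))
  let f : (Fin l × Fin 2 → ZMod 3) →ₗ[ZMod 3] (β → ZMod 3) :=
    Bᵀ.mulVecLin ∘ₗ antipodal (ZMod 3) l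
  have hcz : (c : ZMod 3) = 0 := (ZMod.intCast_zmod_eq_zero_iff_dvd _ 3).2 hc
  have hB (p q) : ∑ b, B p b * B q b =
      (if p = q then (c : ZMod 3) else 0) + 1 + (cycleUnion l p q : ZMod 3) := by
    have := congrArg (Int.cast : ℤ → ZMod 3) (hA p q)
    push_cast at this
    exact this
  have hBB (w) (p) : (B *ᵥ (Bᵀ *ᵥ w)) p =
      ∑ q, w q + ∑ q, (cycleUnion l p q : ZMod 3) * w q := by
    have h := sum_gram_mul (c : ZMod 3) w p
    rw [hcz, zero_mul, zero_add] at h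
    rw [← h, mulVec_mulVec]
    simp only [mulVec, dotProduct, mul_apply, transpose_apply, hB, hcz]
  have hiso : ∀ z ∈ LinearMap.ker f, z ⬝ᵥ z = 0 := by
    intro z hz
    -- The integral lift is needed because the argument uses divisibility by 9, which is invisible
    -- in `ZMod 3`.
    let y : Fin l × Fin 2 → ℤ := fun p => (z p).val
    have hy (p) : ((y p : ℤ) : ZMod 3) = z p := by simp [y]
    have hanti (p) : ((antipodal ℤ l y p : ℤ) : ZMod 3) = antipodal (ZMod 3) l z p := by
      obtain i | i | ⟨j, i⟩ := p
      · simp [antipodal]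
      · simp [antipodal]
      · fin_cases i <;> simp [antipodal, hy]
    have hdvd (b) : (3 : ℤ) ∣ ∑ p, A p b * antipodal ℤ l y p := by
      apply (ZMod.intCast_zmod_eq_zero_iff_dvd _ 3).1
      have := congrFun (LinearMap.mem_ker.1 hz) b
      push_cast
      simp only [hanti]
      exact this
    have hsq : ∑ b, (∑ p, A p b * antipodal ℤ l y p) * (∑ p, A p b * antipodal ℤ l y p) =
        c * (2 * ∑ p, y p * y p) := by
      rw [← sum_antipodal_sq, Finset.mul_sum]
      simp only [Finset.sum_mul_sum]
      rw [Finset.sum_comm]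
      refine Finset.sum_congr rfl fun p _ => ?_
      have h := sum_gram_mul c (antipodal ℤ l y) p
      have h0 := sum_cycleUnion_antipodal y p
      rw [sum_antipodal, add_zero, h0, add_zero] at h
      simp only [← hA] at h
      rw [mul_left_comm, ← h, Finset.sum_comm, Finset.mul_sum]
      refine Finset.sum_congr rfl fun q _ => ?_
      rw [Finset.sum_mul, Finset.mul_sum]
      exact Finset.sum_congr rfl fun b _ => by ring
    have h9 : (9 : ℤ) ∣ c * (2 * ∑ p, y p * y p) := by
      rw [← hsq]
      exact Finset.dvd_sum fun b _ => mul_dvd_mul (hdvd b) (hdvd b)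
    have h3 : (3 : ℤ) ∣ ∑ p, y p * y p := by
      obtain ⟨m, rfl⟩ := hc
      have h : (3 : ℤ) ∣ m * (2 * ∑ p, y p * y p) := by
        rw [mul_assoc] at h9
        exact (mul_dvd_mul_iff_left (by norm_num : (3 : ℤ) ≠ 0)).1 h9
      have hm : ¬ (3 : ℤ) ∣ m := fun h => hc' (mul_dvd_mul_left 3 h)
      have h2 := (Int.prime_three.dvd_or_dvd h).resolve_left hm
      exact (Int.prime_three.dvd_or_dvd h2).resolve_left (by norm_num)
    have := (ZMod.intCast_zmod_eq_zero_iff_dvd _ 3).2 h3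
    push_cast at this
    simpa [hy, dotProduct] using this
  have hlt := finrank_lt_of_isotropic (F := ZMod 3) two_ne neg_one hodd
    (by simp [mul_comm]) _ hiso
  have hrange : LinearMap.range f ≤ LinearMap.ker B.mulVecLin := by
    rintro _ ⟨z, rfl⟩
    ext p
    change (B *ᵥ (Bᵀ *ᵥ antipodal (ZMod 3) l z)) p = 0
    rw [hBB, sum_antipodal, sum_cycleUnion_antipodal, add_zero]
  have hker : LinearMap.ker Bᵀ.mulVecLin ≤ (LinearMap.ker f).map (antipodal (ZMod 3) l) := by
    intro w hw
    have hw' := eq_antipodal hl w fun p => by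
      rw [← hBB, show Bᵀ *ᵥ w = 0 from hw, mulVec_zero]; rfl
    refine ⟨_, ?_, hw'⟩
    change Bᵀ.mulVecLin (antipodal (ZMod 3) l _) = 0
    rw [hw']
    exact hw
  -- With `d = dim ker B = dim ker Bᵀ`, the inclusions give `dim range f ≤ d ≤ dim ker f`, so `2 * l
  -- ≤ 2 * dim ker f`.
  have h1 := LinearMap.finrank_range_add_finrank_ker f
  have h2 := LinearMap.finrank_range_add_finrank_ker B.mulVecLin
  have h3 := LinearMap.finrank_range_add_finrank_ker Bᵀ.mulVecLin
  have h4 : Module.finrank _ (LinearMap.range Bᵀ.mulVecLin) =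
    Module.finrank _ (LinearMap.range B.mulVecLin) := B.rank_transpose
  have h5 := Submodule.finrank_mono hrange
  have h6 := (Submodule.finrank_mono hker).trans (Submodule.finrank_map_le _ _)
  rw [Module.finrank_fintype_fun_eq_card] at h1 h2 h3
  rw [Fintype.card_prod, Fintype.card_fin, Fintype.card_fin] at h1
  omega

/-! ### Degrees in the excess and the replication number. -/

theorem sum_mult_eq_two {V : Type*} [Fintype V] {G : Multigraph V} {l : ℕ}
    (e : CyclePoints l ≃ V) (he : ∀ p q, G.mult (e p) (e q) = cycleUnion l p q) (x : V) :
    ∑ y, G.mult x y = 2 := by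
  obtain ⟨p, rfl⟩ := e.surjective x
  rw [← e.sum_comp]
  simp only [he]
  zify
  obtain i | i | ⟨j, i⟩ := p
  · simpa using sum_cycleUnion_inl (R := ℤ) (l := l) 1 i
  · simpa using sum_cycleUnion_inr_inl (R := ℤ) (l := l) 1 i
  · simpa using sum_cycleUnion_inr_inr (R := ℤ) (l := l) 1 j i

theorem pairCount_eq_excess_add_one {V : Type*} [Fintype V] [DecidableEq V] {v k : ℕ}
    (C : Covering V v k 1) {x y : V} (h : x ≠ y) :
    pairCount C.blocks x y = C.excess.mult x y + 1 := by
  have := C.covers x y h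
  simp only [Covering.excess, if_neg h]
  omega

/-- If every vertex of the excess has degree 2 and `v = k * (k - 1) - 1`, then every point lies in
exactly `k` blocks. -/
theorem pairCount_self {V : Type*} [Fintype V] [DecidableEq V] {v k : ℕ} (hk : 2 ≤ k)
    (hv : v + 1 = k * (k - 1)) (C : Covering V v k 1) (hC : C.IsSymmetric) (x : V)
    (hx : ∑ y, C.excess.mult x y = 2) : pairCount C.blocks x x = k := by
  obtain ⟨f, hf⟩ := exists_eq_map_univ C.blocks (hC.trans C.card_points.symm)
  have hfk (b) : (f b).card = k := C.card_block _ (by rw [hf]; simp)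
  have h := sum_pairCount hfk x
  rw [← hf, ← Finset.add_sum_erase _ _ (Finset.mem_univ x)] at h
  rw [← Finset.add_sum_erase _ _ (Finset.mem_univ x), C.excess.loopless, zero_add] at hx
  rw [Finset.sum_congr rfl fun y hy =>
      pairCount_eq_excess_add_one C (Finset.ne_of_mem_erase hy).symm,
    Finset.sum_add_distrib, hx, Finset.sum_const, Finset.card_erase_of_mem (Finset.mem_univ x),
    Finset.card_univ, C.card_points, smul_eq_mul, mul_one] at h
  obtain ⟨m, rfl⟩ : ∃ m, k = m + 1 := ⟨k - 1, by omega⟩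
  have hv1 : 1 ≤ v := by
    rw [← C.card_points]
    exact Fintype.card_pos_iff.2 ⟨x⟩
  rw [Nat.add_sub_cancel] at hv
  -- If `x` lies in `r` blocks, counting pairs gives `r * k = r + (v - 1) + 2`, hence `r * (k - 1) =
  -- v + 1 = k * (k - 1)`.
  have h' : pairCount C.blocks x x * m = (m + 1) * m := by
    rw [Nat.mul_succ] at h
    omega
  exact Nat.eq_of_mul_eq_mul_right (by omega) h'

end SymmCovering

open SymmCovering in
theorem mainTheorem12 (k v : ℕ)
    (hk : k ≡ 7 [MOD 72] ∨ k ≡ 31 [MOD 72] ∨ k ≡ 34 [MOD 72] ∨ k ≡ 58 [MOD 72])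
    (hv : v = k * (k - 1) - 1)
    {V : Type*} [Fintype V] [DecidableEq V]
    (C : SymmCovering.Covering V v k 1) (hC : C.IsSymmetric) :
    ¬ C.excess.HasCycleType (2 :: 3 :: List.replicate ((v - 5) / 4) 4) := by
  intro h
  obtain ⟨e, he⟩ := h.exists_equiv_cyclePoints
  have hk2 : 2 ≤ k := by simp only [Nat.ModEq] at hk; omega
  obtain ⟨c, rfl⟩ : ∃ c, k = c + 1 := ⟨k - 1, by omega⟩
  rw [Nat.add_sub_cancel] at hv
  have hv' : v + 1 = (c + 1) * c := by
    have : 0 < (c + 1) * c := Nat.mul_pos (by omega) (by omega)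
    omega
  -- Thus `v` is 41 or 65 modulo 72, so `(v - 5) / 4` is exact and is 9 or 15 modulo 18, an odd
  -- multiple of 3.
  have hmod : (v + 1) % 72 = 42 ∨ (v + 1) % 72 = 66 := by
    have hc : c % 72 = 6 ∨ c % 72 = 30 ∨ c % 72 = 33 ∨ c % 72 = 57 := by
      simp only [Nat.ModEq] at hk
      omega
    rw [hv', Nat.mul_mod, Nat.add_mod]
    rcases hc with hc | hc | hc | hc <;> simp [hc]
  obtain ⟨f, hf⟩ := exists_eq_map_univ C.blocks (hC.trans C.card_points.symm)
  refine not_exists_gram (l := (v - 5) / 4) (by omega) (Nat.odd_iff.2 (by omega)) (c := c)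
    (by simp only [Nat.ModEq] at hk; omega) (by simp only [Nat.ModEq] at hk; omega)
    (Fintype.card_congr e.symm) (Matrix.of fun p b => if e p ∈ f b then 1 else 0) fun p q => ?_
  have hpq := pairCount_eq_sum f (e p) (e q)
  rw [← hf] at hpq
  zify at hpq
  simp only [Matrix.of_apply, ← hpq]
  by_cases heq : p = q
  · subst heq
    rw [pairCount_self hk2 (by simpa using hv') C hC _ (sum_mult_eq_two e he _), ← he,
      C.excess.loopless]
    simp
  · rw [pairCount_eq_excess_add_one C (e.injective.ne heq), he, if_neg heq]
    push_cast
    ring
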